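/- Let $\mathcal S$ be the set of symmetric entrywise nonnegative matrices in $\mathbb{R}^{m\times m}$ with zero diagonal. Fix $S\in\mathcal S$, a polynomial graph filter $h(S)=\sum_{i=0}^p h_iS^i$, and $\alpha>0$. Let $w$ be a random vector in $\mathbb{R}^m$ with $\mathbb{E}[w]=0$ and $\mathbb{E}[ww^\top]=I$ whose distribution is sub-Gaussian, i.e. there are constants $C,v>0$ with $\mathbb{P}(\|w\|_2>t)\le Ce^{-vt^2}$ for all $t>0$. Let $x=h(S)w$, let $C_\infty$ be the covariance matrix of $x$, and let $C_n=\frac1n\sum_{k=1}^n x_kx_k^\top$, where $x_k=h(S)w_k$ and $w_1,\dots,w_n$ are independent copies of $w$. Let $f^*$ be the optimal value of $$\min_{T}\ \sum_{i,j}|T_{ij}|-\alpha\sum_{i}\log\Big(\sum_jT_{ij}\Big)\quad\text{s.t.}\quad T\in\mathcal S,\ TC_\infty=C_\infty T,$$ where $-\log 0=+\infty$. Assume $f^*<+\infty$ (for instance, the graph of $S$ has no isolated node), and let $\rho=\max\{f^*,\alpha m,\alpha m(\log\alpha-1)\}$. Then there are constants $K,A>0$, independent of $n$, such that for every $n\ge1$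 and every $\delta_n\ge K\sqrt{\log n/n}$ (in particular for the choice $\delta_n=K\sqrt{\log n/n}$, which is of order $\sqrt{\log n/n}$), $$\mathbb{P}\big(\delta_n\ge 2\rho\,\|C_n-C_\infty\|\big)\ \ge\ 1-\frac{A}{n},$$ where $\|\cdot\|$ is the operator norm induced by the Euclidean norm. -/

import Mathlib

open MeasureTheory ProbabilityTheory
open scoped Matrix Matrix.Norms.L2Operator

noncomputable section

namespace LogSpecT

/-- Valid adjacency matrices of weighted undirected graphs on `m` nodes without self-loops. -/
def adjacencySet (m : ℕ) : Set (Matrix (Fin m) (Fin m) ℝ) :=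
  {S | S = Sᵀ ∧ (∀ i, S i i = 0) ∧ ∀ i j, 0 ≤ S i j}

/-- The polynomial graph filter `h(S) = ∑_{i=0}^p h_i S^i`. -/
def graphFilter {m p : ℕ} (h : Fin (p + 1) → ℝ) (S : Matrix (Fin m) (Fin m) ℝ) :
    Matrix (Fin m) (Fin m) ℝ :=
  ∑ i : Fin (p + 1), h i • S ^ (i : ℕ)

/-- The graph signal `x = h(S) w`. -/
def graphSignal {m p : ℕ} (h : Fin (p + 1) → ℝ) (S : Matrix (Fin m) (Fin m) ℝ)
    (w : EuclideanSpace ℝ (Fin m)) : Fin m → ℝ :=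
  graphFilter h S *ᵥ w.ofLp

/-- The distribution `μ` of a random vector is sub-Gaussian: for some positive constants `C`, `v`,
`ℙ(‖w‖₂ > t) ≤ C exp(-v t²)` for all `t > 0`. -/
def IsSubGaussian {m : ℕ} (μ : Measure (EuclideanSpace ℝ (Fin m))) : Prop :=
  ∃ C > 0, ∃ v > 0, ∀ t : ℝ, 0 < t → μ.real {w | t < ‖w‖} ≤ C * Real.exp (-v * t ^ 2)

/-- A random vector with distribution `μ` has `𝔼[w] = 0` and `𝔼[w wᵀ] = I`. -/
def IsWhite {m : ℕ} (μ : Measure (EuclideanSpace ℝ (Fin m))) : Prop :=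
  (∀ i, ∫ w, w i ∂μ = 0) ∧
    ∀ i j, ∫ w, w i * w j ∂μ = (1 : Matrix (Fin m) (Fin m) ℝ) i j

/-- `C_∞`: the covariance matrix of `x = h(S) w`, where `w` has distribution `μ`. -/
def trueCov {m p : ℕ} (h : Fin (p + 1) → ℝ) (S : Matrix (Fin m) (Fin m) ℝ)
    (μ : Measure (EuclideanSpace ℝ (Fin m))) : Matrix (Fin m) (Fin m) ℝ :=
  Matrix.of fun i j => cov[fun w => graphSignal h S w i, fun w => graphSignal h S w j; μ]

/-- `C_n = (1/n) ∑_k x_k x_kᵀ`: the sample covariance matrix of (mean-zero) signals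
`x_1, …, x_n`. -/
def sampleCov {m n : ℕ} (x : Fin n → Fin m → ℝ) : Matrix (Fin m) (Fin m) ℝ :=
  (n : ℝ)⁻¹ • ∑ k, Matrix.vecMulVec (x k) (x k)

/-- The objective `f(T) = ‖T‖_{1,1} - α 1ᵀ log(T 1)`, for `T` with `T 1 > 0`. -/
def objective {m : ℕ} (α : ℝ) (T : Matrix (Fin m) (Fin m) ℝ) : ℝ :=
  ∑ i, ∑ j, |T i j| - α * ∑ i, Real.log (∑ j, T i j)

/-- The matrices feasible for LogSpecT with covariance matrix `C` at which the objective is finite: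
`T` is a valid adjacency matrix, `T C = C T`, and `T 1 > 0`
(the logarithmic barrier is `+∞` as soon as a node of `T` is isolated). -/
def feasibleSet {m : ℕ} (C : Matrix (Fin m) (Fin m) ℝ) : Set (Matrix (Fin m) (Fin m) ℝ) :=
  {T | T ∈ adjacencySet m ∧ T * C = C * T ∧ ∀ i, 0 < ∑ j, T i j}

/-- The optimal value `f*` of LogSpecT (the infimum of a set that is bounded below for `α > 0`;
used only when LogSpecT is feasible). -/
def optimalValue {m : ℕ} (α : ℝ) (C : Matrix (Fin m) (Fin m) ℝ) : ℝ :=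
  sInf (objective α '' feasibleSet C)

/-- `ρ = max {f*, α m, α m (log α - 1)}`. -/
def rho {m : ℕ} (α : ℝ) (C : Matrix (Fin m) (Fin m) ℝ) : ℝ :=
  max (optimalValue α C) (max (α * m) (α * m * (Real.log α - 1)))

end LogSpecT

end

/-!
The error `C_n - C_∞` is controlled entry by entry. Each entry of `x xᵀ - C_∞` is a centred random
variable bounded by a quadratic function of `‖w‖`, and the sub-Gaussian tail makes
`exp (s ‖w‖²)` integrable for some `s > 0` (`IsSubGaussian.exists_integrable_exp_mul_sq_norm`).
So such an entry `Y` has exponential moments in a neighbourhood of zero and, being centred,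
satisfies `𝔼[exp (t Y)] ≤ exp (B t²)` for small `t` (`mgf_le_exp_mul_sq`). The Chernoff bound with
`t` proportional to `√(log n / n)`, a quantity that never exceeds `1` and hence keeps `t` in the
admissible neighbourhood for every `n`, shows that the empirical mean of `Y` exceeds
`K √(log n / n)` with probability at most `1 / n` (`exists_measureReal_mean_ge_le`).
A union bound over the entries and the two signs, together with the bound of the operator norm by
the sum of the absolute values of the entries, gives the result with `A = 2 m² + 1`.
-/

open MeasureTheory ProbabilityTheory
open scoped Matrix Matrix.Norms.L2Operator

namespace LogSpecT

/-! ### The operator norm and the entries of a matrix -/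

lemma l2_opNorm_single {ι : Type*} [Fintype ι] [DecidableEq ι] (i j : ι) (a : ℝ) :
    ‖Matrix.single i j a‖ = |a| := by
  have h := Matrix.l2_opNorm_conjTranspose_mul_self (Matrix.single i j a)
  have h2 : (Matrix.single i j a)ᴴ * Matrix.single i j a
      = Matrix.diagonal (Pi.single j (a * a)) := by
    rw [Matrix.conjTranspose_single, Matrix.single_mul_single_same, Matrix.diagonal_single]
    simp
  rw [h2, Matrix.l2_opNorm_diagonal, Pi.norm_single, norm_mul, Real.norm_eq_abs] at h
  nlinarith [norm_nonneg (Matrix.single i j a), abs_nonneg a,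
    mul_self_inj (norm_nonneg (Matrix.single i j a)) (abs_nonneg a)]

lemma l2_opNorm_le_sum_abs {ι : Type*} [Fintype ι] [DecidableEq ι] (M : Matrix ι ι ℝ) :
    ‖M‖ ≤ ∑ i, ∑ j, |M i j| := by
  conv_lhs => rw [Matrix.matrix_eq_sum_single M]
  refine (norm_sum_le _ _).trans (Finset.sum_le_sum fun i _ => (norm_sum_le _ _).trans ?_)
  exact Finset.sum_le_sum fun j _ => (l2_opNorm_single i j _).le

/-! ### Exponential moments -/

lemma IsSubGaussian.exists_integrable_exp_mul_sq_norm {m : ℕ}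
    {μ : Measure (EuclideanSpace ℝ (Fin m))} [IsProbabilityMeasure μ] (hμ : IsSubGaussian μ) :
    ∃ s > 0, Integrable (fun w => Real.exp (s * ‖w‖ ^ 2)) μ := by
  obtain ⟨C, hC, v, hv, h⟩ := hμ
  refine ⟨v / 2, by positivity, ?_⟩
  have hm : Measurable fun w : EuclideanSpace ℝ (Fin m) => Real.exp (v / 2 * ‖w‖ ^ 2) := by
    fun_prop
  refine ⟨hm.aestronglyMeasurable, ?_⟩
  rw [hasFiniteIntegral_iff_ofReal (ae_of_all _ fun w => (Real.exp_pos _).le),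
    lintegral_eq_lintegral_meas_lt μ (ae_of_all _ fun w => (Real.exp_pos _).le) hm.aemeasurable,
    ← Set.Ioc_union_Ioi_eq_Ioi (zero_le_one (α := ℝ))]
  refine (lintegral_union_le _ _ _).trans_lt (ENNReal.add_lt_top.2 ⟨?_, ?_⟩)
  · refine (setLIntegral_mono' measurableSet_Ioc fun u _ => prob_le_one).trans_lt ?_
    simp
  · -- The exponent `-v` in the tail is twice `v / 2`, so the tail of `exp (v / 2 * ‖w‖²)` decays
    -- like `u⁻²`.
    have htail : ∀ u ∈ Set.Ioi (1 : ℝ),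
        μ {w | u < Real.exp (v / 2 * ‖w‖ ^ 2)} ≤ ENNReal.ofReal (C * u ^ (-2 : ℝ)) := by
      intro u hu
      have hu1 : 1 < u := hu
      have hu0 : 0 < u := by linarith
      have hlog : 0 < Real.log u := Real.log_pos hu1
      have hset : {w : EuclideanSpace ℝ (Fin m) | u < Real.exp (v / 2 * ‖w‖ ^ 2)}
          ⊆ {w | √(2 * Real.log u / v) < ‖w‖} := by
        intro w hw
        have h1 : Real.log u < v / 2 * ‖w‖ ^ 2 := (Real.log_lt_iff_lt_exp hu0).2 hw
        refine (Real.sqrt_lt (by positivity) (norm_nonneg w)).2 ?_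
        rw [div_lt_iff₀ hv]
        linarith
      have h2 := h (√(2 * Real.log u / v)) (by positivity)
      rw [Real.sq_sqrt (by positivity)] at h2
      have h3 : -v * (2 * Real.log u / v) = Real.log u * (-2) := by field_simp
      rw [h3, ← Real.rpow_def_of_pos hu0] at h2
      calc _ ≤ μ {w | √(2 * Real.log u / v) < ‖w‖} := measure_mono hset
        _ = ENNReal.ofReal (μ.real {w | √(2 * Real.log u / v) < ‖w‖}) := by simp
        _ ≤ _ := ENNReal.ofReal_le_ofReal h2
    refine (setLIntegral_mono' measurableSet_Ioi htail).trans_lt ?_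
    have hint : IntegrableOn (fun u : ℝ => C * u ^ (-2 : ℝ)) (Set.Ioi 1) :=
      (integrableOn_Ioi_rpow_of_lt (by norm_num) one_pos).const_mul C
    exact hint.lintegral_lt_top

lemma exp_le_one_add_add_sq_mul_exp_abs (x : ℝ) :
    Real.exp x ≤ 1 + x + x ^ 2 * Real.exp |x| := by
  have h1 : 1 ≤ Real.exp |x| := Real.one_le_exp (abs_nonneg x)
  rcases le_or_gt |x| 1 with hx | hx
  · have := (abs_le.1 (Real.abs_exp_sub_one_sub_id_le hx)).2
    nlinarith [sq_nonneg x]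
  · rcases le_or_gt 0 x with h0 | h0
    · rw [abs_of_nonneg h0] at *
      nlinarith [mul_nonneg (by nlinarith : (0 : ℝ) ≤ x ^ 2 - 1) (Real.exp_pos x).le]
    · rw [abs_of_neg h0] at *
      have : Real.exp x ≤ 1 := Real.exp_le_one_iff.2 h0.le
      nlinarith [sq_nonneg x]

lemma integrable_exp_mul_of_abs_le {E : Type*} [MeasurableSpace E] {μ : Measure E}
    {Y : E → ℝ} (hY : AEMeasurable Y μ) {r t : ℝ} (ht : |t| ≤ r)
    (hint : Integrable (fun e => Real.exp (r * |Y e|)) μ) :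
    Integrable (fun e => Real.exp (t * Y e)) μ := by
  refine hint.mono' (by fun_prop) (ae_of_all _ fun e => ?_)
  rw [Real.norm_eq_abs, Real.abs_exp, Real.exp_le_exp]
  calc t * Y e ≤ |t * Y e| := le_abs_self _
    _ = |t| * |Y e| := abs_mul _ _
    _ ≤ r * |Y e| := by gcongr

/-- A centred variable with exponential moments has a moment generating function of sub-Gaussian
shape near zero: the linear term of the expansion of the exponential integrates to zero. -/
lemma mgf_le_exp_mul_sq {E : Type*} [MeasurableSpace E] {μ : Measure E} [IsProbabilityMeasure μ]
    {Y : E → ℝ} (hY : AEMeasurable Y μ) (hmean : ∫ e, Y e ∂μ = 0) {r : ℝ} (hr : 0 < r)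
    (hint : Integrable (fun e => Real.exp (2 * r * |Y e|)) μ) {t : ℝ} (ht : |t| ≤ r) :
    mgf Y μ t ≤ Real.exp (2 / r ^ 2 * (∫ e, Real.exp (2 * r * |Y e|) ∂μ) * t ^ 2) := by
  have hpt : ∀ e, Real.exp (t * Y e)
      ≤ 1 + t * Y e + 2 / r ^ 2 * t ^ 2 * Real.exp (2 * r * |Y e|) := by
    intro e
    have h1 := exp_le_one_add_add_sq_mul_exp_abs (t * Y e)
    have h2 : Real.exp |t * Y e| ≤ Real.exp (r * |Y e|) := by
      rw [Real.exp_le_exp, abs_mul]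
      gcongr
    have h3 : Y e ^ 2 ≤ 2 / r ^ 2 * Real.exp (r * |Y e|) := by
      have h4 := Real.quadratic_le_exp_of_nonneg (x := r * |Y e|) (by positivity)
      rw [div_mul_eq_mul_div, le_div_iff₀ (by positivity)]
      have h5 : 0 ≤ r * |Y e| := by positivity
      rw [mul_pow, sq_abs] at h4
      linarith
    have h4 : (t * Y e) ^ 2 * Real.exp |t * Y e|
        ≤ 2 / r ^ 2 * t ^ 2 * Real.exp (2 * r * |Y e|) := by
      calc (t * Y e) ^ 2 * Real.exp |t * Y e|
          = t ^ 2 * (Y e ^ 2 * Real.exp |t * Y e|) := by ring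
        _ ≤ t ^ 2 * (2 / r ^ 2 * Real.exp (r * |Y e|) * Real.exp (r * |Y e|)) := by gcongr
        _ = _ := by
          rw [mul_assoc (2 / r ^ 2), ← Real.exp_add]
          ring_nf
    linarith
  have hYint : Integrable Y μ := by
    refine (hint.const_mul (1 / (2 * r))).mono' hY.aestronglyMeasurable (ae_of_all _ fun e => ?_)
    have := Real.add_one_le_exp (2 * r * |Y e|)
    rw [Real.norm_eq_abs, one_div_mul_eq_div, le_div_iff₀ (by positivity)]
    linarith
  have hlin : Integrable (fun e => 1 + t * Y e) μ :=
    (integrable_const 1).add (hYint.const_mul t)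
  calc mgf Y μ t
      ≤ ∫ e, (1 + t * Y e + 2 / r ^ 2 * t ^ 2 * Real.exp (2 * r * |Y e|)) ∂μ :=
        integral_mono (integrable_exp_mul_of_abs_le hY (by linarith) hint)
          (hlin.add (hint.const_mul _)) hpt
    _ = 2 / r ^ 2 * (∫ e, Real.exp (2 * r * |Y e|) ∂μ) * t ^ 2 + 1 := by
        rw [integral_add hlin (hint.const_mul _), integral_const_mul,
          integral_add (integrable_const 1) (hYint.const_mul t), integral_const_mul, hmean]
        simp
        ring
    _ ≤ _ := Real.add_one_le_exp _

/-! ### Concentration of empirical means -/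

/-- Bernstein-type deviation bound at the scale `√(log n / n)`; the constant depends only on the
law `μ`, and not on the number of samples or on the space that carries them. -/
lemma exists_measureReal_mean_ge_le {E : Type*} [MeasurableSpace E] {μ : Measure E}
    [IsProbabilityMeasure μ] {Y : E → ℝ} (hY : Measurable Y) (hmean : ∫ e, Y e ∂μ = 0) {r : ℝ}
    (hr : 0 < r) (hint : Integrable (fun e => Real.exp (2 * r * |Y e|)) μ) :
    ∃ K > 0, ∀ n : ℕ, 1 ≤ n → ∀ (Ω : Type*) [MeasurableSpace Ω] (P : Measure Ω)
      [IsProbabilityMeasure P] (w : Fin n → Ω → E), (∀ k, HasLaw (w k) μ P) → iIndepFun w P →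
      P.real {ω | K * √(Real.log n / n) ≤ (n : ℝ)⁻¹ * ∑ k, Y (w k ω)} ≤ 1 / n := by
  set B : ℝ := 2 / r ^ 2 * ∫ e, Real.exp (2 * r * |Y e|) ∂μ with hB
  have hB0 : 0 ≤ B := mul_nonneg (by positivity) (integral_nonneg fun e => (Real.exp_pos _).le)
  -- This value makes the Chernoff exponent at `r * √(log n / n)` equal to `-log n`.
  refine ⟨(1 + B * r ^ 2) / r, by positivity, fun n hn Ω _ P _ w hw hind => ?_⟩
  have hn0 : (0 : ℝ) < n := by exact_mod_cast hn
  have hlog : 0 ≤ Real.log n := Real.log_natCast_nonneg n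
  set q : ℝ := √(Real.log n / n) with hq
  have hq0 : 0 ≤ q := Real.sqrt_nonneg _
  have hqsq : q ^ 2 = Real.log n / n := Real.sq_sqrt (by positivity)
  have hq1 : q ≤ 1 := by
    rw [hq, Real.sqrt_le_one, div_le_one hn0]
    exact (Real.log_le_sub_one_of_pos hn0).trans (by linarith)
  have ht0 : 0 ≤ r * q := by positivity
  have ht : |r * q| ≤ r := by
    rw [abs_of_nonneg ht0]
    nlinarith
  have hYm : ∀ k, AEMeasurable (fun ω => Y (w k ω)) P := fun k =>
    hY.comp_aemeasurable (hw k).aemeasurable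
  have hYind : iIndepFun (fun k ω => Y (w k ω)) P := hind.comp (fun _ => Y) fun _ => hY
  have hmgf : ∀ k, mgf (fun ω => Y (w k ω)) P (r * q) = mgf Y μ (r * q) := by
    intro k
    rw [← (hw k).map_eq, mgf_map (hw k).aemeasurable (by fun_prop)]
    rfl
  have hexp : ∀ k, Integrable (fun ω => Real.exp (r * q * Y (w k ω))) P := by
    intro k
    have h1 : Integrable (fun e => Real.exp (r * q * Y e)) μ :=
      integrable_exp_mul_of_abs_le hY.aemeasurable (ht.trans (by linarith)) hint
    rw [← (hw k).map_eq] at h1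
    exact h1.comp_aemeasurable (hw k).aemeasurable
  have hsum : Integrable
      (fun ω => Real.exp (r * q * (∑ k, fun ω => Y (w k ω)) ω)) P := by
    refine .of_integral_ne_zero ?_
    change mgf (∑ k, fun ω => Y (w k ω)) P (r * q) ≠ 0
    rw [hYind.mgf_sum₀ hYm]
    exact Finset.prod_ne_zero_iff.2 fun k _ => (mgf_pos (hexp k)).ne'
  have hch := measure_ge_le_exp_mul_mgf (n * ((1 + B * r ^ 2) / r * q)) ht0 hsum
  rw [hYind.mgf_sum₀ hYm] at hch
  simp only [hmgf, Finset.prod_const, Finset.card_univ, Fintype.card_fin] at hch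
  have hset : {ω | (1 + B * r ^ 2) / r * q ≤ (n : ℝ)⁻¹ * ∑ k, Y (w k ω)}
      = {ω | n * ((1 + B * r ^ 2) / r * q) ≤ (∑ k, fun ω => Y (w k ω)) ω} := by
    ext ω
    simp only [Set.mem_ofPred_eq, Finset.sum_apply]
    rw [inv_mul_eq_div, le_div_iff₀ hn0, mul_comm]
  rw [hset]
  calc _ ≤ _ := hch
    _ ≤ Real.exp (-(r * q) * (n * ((1 + B * r ^ 2) / r * q)))
        * Real.exp (B * (r * q) ^ 2) ^ n := by
        gcongr
        · exact mgf_nonneg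
        · exact mgf_le_exp_mul_sq hY.aemeasurable hmean hr hint ht
    _ = Real.exp (-Real.log n) := by
        rw [← Real.exp_nat_mul, ← Real.exp_add]
        congr 1
        have h1 : -(r * q) * (n * ((1 + B * r ^ 2) / r * q)) + n * (B * (r * q) ^ 2)
            = -(n * q ^ 2) := by
          field_simp
          ring
        rw [h1, hqsq]
        field_simp
    _ = 1 / n := by rw [Real.exp_neg, Real.exp_log hn0, one_div]

lemma exists_measureReal_abs_mean_ge_le {E : Type*} [MeasurableSpace E] {μ : Measure E}
    [IsProbabilityMeasure μ] {Y : E → ℝ} (hY : Measurable Y) (hmean : ∫ e, Y e ∂μ = 0) {r : ℝ}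
    (hr : 0 < r) (hint : Integrable (fun e => Real.exp (2 * r * |Y e|)) μ) :
    ∃ K > 0, ∀ n : ℕ, 1 ≤ n → ∀ (Ω : Type*) [MeasurableSpace Ω] (P : Measure Ω)
      [IsProbabilityMeasure P] (w : Fin n → Ω → E), (∀ k, HasLaw (w k) μ P) → iIndepFun w P →
      P.real {ω | K * √(Real.log n / n) ≤ |(n : ℝ)⁻¹ * ∑ k, Y (w k ω)|} ≤ 2 / n := by
  obtain ⟨K, hK, h⟩ := exists_measureReal_mean_ge_le hY hmean hr hint
  obtain ⟨K', hK', h'⟩ := exists_measureReal_mean_ge_le (μ := μ) (Y := fun e => -Y e) hY.neg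
    (by rw [integral_neg, hmean, neg_zero]) hr (by simpa only [abs_neg] using hint)
  refine ⟨max K K', lt_max_of_lt_left hK, fun n hn Ω _ P _ w hw hind => ?_⟩
  have hsub : {ω | max K K' * √(Real.log n / n) ≤ |(n : ℝ)⁻¹ * ∑ k, Y (w k ω)|}
      ⊆ {ω | K * √(Real.log n / n) ≤ (n : ℝ)⁻¹ * ∑ k, Y (w k ω)}
        ∪ {ω | K' * √(Real.log n / n) ≤ (n : ℝ)⁻¹ * ∑ k, -Y (w k ω)} := by
    intro ω hω
    rw [Set.mem_ofPred_eq, le_abs] at hω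
    have hle := mul_le_mul_of_nonneg_right (le_max_left K K') (Real.sqrt_nonneg (Real.log n / n))
    have hle' := mul_le_mul_of_nonneg_right (le_max_right K K')
      (Real.sqrt_nonneg (Real.log n / n))
    refine hω.imp (fun h1 => hle.trans h1) fun h1 => ?_
    rw [Set.mem_ofPred_eq, Finset.sum_neg_distrib, mul_neg]
    exact hle'.trans h1
  calc _ ≤ _ := measureReal_mono hsub
    _ ≤ _ := measureReal_union_le _ _
    _ ≤ 1 / n + 1 / n := add_le_add (h n hn Ω P w hw hind) (h' n hn Ω P w hw hind)
    _ = 2 / n := by ring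

/-! ### Graph signals -/

lemma measurable_graphSignal {m p : ℕ} (h : Fin (p + 1) → ℝ) (S : Matrix (Fin m) (Fin m) ℝ)
    (i : Fin m) : Measurable fun w => graphSignal h S w i := by
  simp only [graphSignal, Matrix.mulVec, dotProduct]
  fun_prop

lemma abs_graphSignal_le {m p : ℕ} (h : Fin (p + 1) → ℝ) (S : Matrix (Fin m) (Fin m) ℝ)
    (w : EuclideanSpace ℝ (Fin m)) (i : Fin m) :
    |graphSignal h S w i| ≤ ‖graphFilter h S‖ * ‖w‖ := by
  have h1 := PiLp.norm_apply_le
    ((EuclideanSpace.equiv (Fin m) ℝ).symm (graphFilter h S *ᵥ w.ofLp)) i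
  exact h1.trans (Matrix.l2_opNorm_mulVec _ w)

/-- The exponential moment of `‖w‖²` passes to every variable of at most quadratic growth. -/
lemma exists_integrable_exp_mul_abs {m : ℕ} {μ : Measure (EuclideanSpace ℝ (Fin m))}
    [IsProbabilityMeasure μ] (hμ : IsSubGaussian μ) {Y : EuclideanSpace ℝ (Fin m) → ℝ}
    (hY : Measurable Y) {a b : ℝ} (ha : 0 ≤ a) (hbound : ∀ w, |Y w| ≤ a * ‖w‖ ^ 2 + b) :
    ∃ r > 0, Integrable (fun w => Real.exp (2 * r * |Y w|)) μ := by
  obtain ⟨s, hs, hint⟩ := hμ.exists_integrable_exp_mul_sq_norm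
  refine ⟨s / (2 * (a + 1)), by positivity, ?_⟩
  refine (hint.const_mul (Real.exp (s / (a + 1) * b))).mono' (by fun_prop)
    (ae_of_all _ fun w => ?_)
  rw [Real.norm_eq_abs, Real.abs_exp, ← Real.exp_add, Real.exp_le_exp]
  have hq : s / (a + 1) * (a * ‖w‖ ^ 2) ≤ s * ‖w‖ ^ 2 := by
    rw [div_mul_eq_mul_div, div_le_iff₀ (by positivity)]
    nlinarith [mul_nonneg hs.le (sq_nonneg ‖w‖)]
  calc 2 * (s / (2 * (a + 1))) * |Y w| = s / (a + 1) * |Y w| := by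
        congr 1
        field_simp
    _ ≤ s / (a + 1) * (a * ‖w‖ ^ 2 + b) := by
        gcongr
        exact hbound w
    _ ≤ _ := by linarith

lemma IsSubGaussian.memLp_two {m : ℕ} {μ : Measure (EuclideanSpace ℝ (Fin m))}
    [IsProbabilityMeasure μ] (hμ : IsSubGaussian μ) {Y : EuclideanSpace ℝ (Fin m) → ℝ}
    (hY : Measurable Y) {a : ℝ} (hbound : ∀ w, |Y w| ≤ a * ‖w‖) : MemLp Y 2 μ := by
  obtain ⟨s, hs, hint⟩ := hμ.exists_integrable_exp_mul_sq_norm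
  rw [memLp_two_iff_integrable_sq hY.aestronglyMeasurable]
  refine (hint.const_mul (a ^ 2 / s)).mono' (by fun_prop) (ae_of_all _ fun w => ?_)
  have h1 := Real.add_one_le_exp (s * ‖w‖ ^ 2)
  rw [Real.norm_eq_abs, abs_of_nonneg (sq_nonneg _)]
  calc Y w ^ 2 = |Y w| ^ 2 := (sq_abs _).symm
    _ ≤ (a * ‖w‖) ^ 2 := by
        gcongr
        exact hbound w
    _ = a ^ 2 / s * (s * ‖w‖ ^ 2) := by field_simp
    _ ≤ _ := by
        gcongr
        linarith

lemma integral_graphSignal {m p : ℕ} (h : Fin (p + 1) → ℝ) (S : Matrix (Fin m) (Fin m) ℝ)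
    {μ : Measure (EuclideanSpace ℝ (Fin m))} [IsProbabilityMeasure μ] (hwhite : IsWhite μ)
    (hμ : IsSubGaussian μ) (i : Fin m) : ∫ w, graphSignal h S w i ∂μ = 0 := by
  have hcoord : ∀ j, Integrable (fun w : EuclideanSpace ℝ (Fin m) => w j) μ := fun j =>
    (hμ.memLp_two (a := 1) (by fun_prop) fun w => by
      simpa using PiLp.norm_apply_le w j).integrable one_le_two
  simp only [graphSignal, Matrix.mulVec, dotProduct]
  rw [integral_finsetSum _ fun j _ => (hcoord j).const_mul _]
  simp only [integral_const_mul, hwhite.1, mul_zero, Finset.sum_const_zero]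

lemma integral_graphSignal_mul_sub_trueCov {m p : ℕ} (h : Fin (p + 1) → ℝ)
    (S : Matrix (Fin m) (Fin m) ℝ) {μ : Measure (EuclideanSpace ℝ (Fin m))}
    [IsProbabilityMeasure μ] (hwhite : IsWhite μ) (hμ : IsSubGaussian μ) (i j : Fin m) :
    ∫ w, (graphSignal h S w i * graphSignal h S w j - trueCov h S μ i j) ∂μ = 0 := by
  have hL : ∀ i, MemLp (fun w => graphSignal h S w i) 2 μ := fun i =>
    hμ.memLp_two (measurable_graphSignal h S i) fun w => abs_graphSignal_le h S w i
  have hc : trueCov h S μ i j = ∫ w, graphSignal h S w i * graphSignal h S w j ∂μ := by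
    rw [trueCov, Matrix.of_apply, covariance_eq_sub (hL i) (hL j),
      integral_graphSignal h S hwhite hμ i, zero_mul, sub_zero]
    rfl
  have hint : Integrable (fun w => graphSignal h S w i * graphSignal h S w j) μ :=
    (hL i).integrable_mul (hL j)
  rw [integral_sub hint (integrable_const _), ← hc]
  simp

lemma sampleCov_sub_apply {m n : ℕ} (hn : 1 ≤ n) (x : Fin n → Fin m → ℝ)
    (C : Matrix (Fin m) (Fin m) ℝ) (i j : Fin m) :
    (sampleCov x - C) i j = (n : ℝ)⁻¹ * ∑ k, (x k i * x k j - C i j) := by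
  have hn0 : (n : ℝ) ≠ 0 := by exact_mod_cast (by lia : n ≠ 0)
  simp only [sampleCov, Matrix.sub_apply, Matrix.smul_apply, Matrix.sum_apply,
    Matrix.vecMulVec_apply, smul_eq_mul, Finset.sum_sub_distrib, Finset.sum_const,
    Finset.card_univ, Fintype.card_fin, nsmul_eq_mul, mul_sub, inv_mul_cancel_left₀ hn0]

lemma exists_measureReal_entry_ge_le {m p : ℕ} (h : Fin (p + 1) → ℝ)
    (S : Matrix (Fin m) (Fin m) ℝ) {μ : Measure (EuclideanSpace ℝ (Fin m))}
    [IsProbabilityMeasure μ] (hwhite : IsWhite μ) (hμ : IsSubGaussian μ) (i j : Fin m) :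
    ∃ K > 0, ∀ n : ℕ, 1 ≤ n → ∀ (Ω : Type*) [MeasurableSpace Ω] (P : Measure Ω)
      [IsProbabilityMeasure P] (w : Fin n → Ω → EuclideanSpace ℝ (Fin m)),
      (∀ k, HasLaw (w k) μ P) → iIndepFun w P →
      P.real {ω | K * √(Real.log n / n) ≤
        |(sampleCov (fun k => graphSignal h S (w k ω)) - trueCov h S μ) i j|} ≤ 2 / n := by
  have hm : Measurable fun w => graphSignal h S w i * graphSignal h S w j - trueCov h S μ i j :=
    ((measurable_graphSignal h S i).mul (measurable_graphSignal h S j)).sub_const _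
  obtain ⟨r, hr, hint⟩ := exists_integrable_exp_mul_abs hμ hm
    (a := ‖graphFilter h S‖ ^ 2) (b := |trueCov h S μ i j|) (by positivity) fun w => by
      refine (abs_sub _ _).trans ?_
      rw [abs_mul, ← mul_pow, sq (‖graphFilter h S‖ * ‖w‖)]
      gcongr <;> exact abs_graphSignal_le h S w _
  obtain ⟨K, hK, hdev⟩ := exists_measureReal_abs_mean_ge_le hm
    (integral_graphSignal_mul_sub_trueCov h S hwhite hμ i j) hr hint
  refine ⟨K, hK, fun n hn Ω _ P _ w hw hind => ?_⟩
  simp only [sampleCov_sub_apply hn]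
  exact hdev n hn Ω P w hw hind

lemma rho_nonneg {m : ℕ} {α : ℝ} (hα : 0 < α) (C : Matrix (Fin m) (Fin m) ℝ) : 0 ≤ rho α C :=
  le_max_of_le_right (le_max_of_le_left (by positivity))

end LogSpecT

theorem corollary2 {m p : ℕ} (h : Fin (p + 1) → ℝ) (S : Matrix (Fin m) (Fin m) ℝ)
    (hS : S ∈ LogSpecT.adjacencySet m) (α : ℝ) (hα : 0 < α)
    (μ : Measure (EuclideanSpace ℝ (Fin m))) [IsProbabilityMeasure μ]
    (hwhite : LogSpecT.IsWhite μ) (hsub : LogSpecT.IsSubGaussian μ)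
    (hfeas : (LogSpecT.feasibleSet (LogSpecT.trueCov h S μ)).Nonempty) :
    ∃ K > 0, ∃ A > 0, ∀ n : ℕ, 1 ≤ n →
      ∀ (Ω : Type*) [MeasurableSpace Ω] (P : Measure Ω) [IsProbabilityMeasure P]
        (w : Fin n → Ω → EuclideanSpace ℝ (Fin m)),
        (∀ k, HasLaw (w k) μ P) → iIndepFun w P →
        ∀ δ : ℝ, K * √(Real.log n / n) ≤ δ →
          1 - A / n ≤ P.real {ω |
            2 * LogSpecT.rho α (LogSpecT.trueCov h S μ) *
              ‖LogSpecT.sampleCov (fun k => LogSpecT.graphSignal h S (w k ω))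
                - LogSpecT.trueCov h S μ‖ ≤ δ} := by
  choose κ hκ hdev using LogSpecT.exists_measureReal_entry_ge_le h S hwhite hsub
  have hρ := LogSpecT.rho_nonneg hα (LogSpecT.trueCov h S μ)
  set ρ := LogSpecT.rho α (LogSpecT.trueCov h S μ)
  have hκ0 : 0 ≤ ∑ i, ∑ j, κ i j :=
    Finset.sum_nonneg fun i _ => Finset.sum_nonneg fun j _ => (hκ i j).le
  -- The summands `1` only ensure positivity, which could fail for `m = 0`.
  refine ⟨2 * ρ * (∑ i, ∑ j, κ i j) + 1, by positivity, 2 * m ^ 2 + 1, by positivity,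
    fun n hn Ω _ P _ w hw hind δ hδ => ?_⟩
  have hn0 : (0 : ℝ) < n := by exact_mod_cast hn
  set D : Ω → Matrix (Fin m) (Fin m) ℝ := fun ω =>
    LogSpecT.sampleCov (fun k => LogSpecT.graphSignal h S (w k ω)) - LogSpecT.trueCov h S μ
  set q : ℝ := √(Real.log n / n) with hq
  have hq0 : 0 ≤ q := Real.sqrt_nonneg _
  set bad : Set Ω := ⋃ i, ⋃ j, {ω | κ i j * q ≤ |D ω i j|}
  have hbad : P.real bad ≤ (2 * m ^ 2 + 1) / n := by
    calc P.real bad ≤ ∑ i, ∑ j, P.real {ω | κ i j * q ≤ |D ω i j|} :=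
          (measureReal_iUnion_fintype_le _).trans
            (Finset.sum_le_sum fun i _ => measureReal_iUnion_fintype_le _)
      _ ≤ ∑ _i : Fin m, ∑ _j : Fin m, (2 : ℝ) / n :=
          Finset.sum_le_sum fun i _ => Finset.sum_le_sum fun j _ => hdev i j n hn Ω P w hw hind
      _ = 2 * m ^ 2 / n := by
          simp only [Finset.sum_const, Finset.card_univ, Fintype.card_fin, nsmul_eq_mul]
          ring
      _ ≤ _ := by
          gcongr
          linarith
  have hcover : Set.univ ⊆ {ω | 2 * ρ * ‖D ω‖ ≤ δ} ∪ bad := by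
    intro ω _
    rw [Set.mem_union, or_iff_not_imp_right]
    intro hω
    simp only [bad, Set.mem_iUnion, Set.mem_ofPred_eq, not_exists, not_le] at hω
    calc 2 * ρ * ‖D ω‖ ≤ 2 * ρ * ∑ i, ∑ j, κ i j * q := by
          gcongr
          exact (LogSpecT.l2_opNorm_le_sum_abs _).trans
            (Finset.sum_le_sum fun i _ => Finset.sum_le_sum fun j _ => (hω i j).le)
      _ = 2 * ρ * (∑ i, ∑ j, κ i j) * q := by simp only [← Finset.sum_mul, mul_assoc]
      _ ≤ (2 * ρ * (∑ i, ∑ j, κ i j) + 1) * q := by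
          gcongr
          linarith
      _ ≤ δ := hδ
  -- Subadditivity spares the measurability of the two events, as `w k` is only
  -- almost everywhere measurable.
  have h1 : 1 ≤ P.real {ω | 2 * ρ * ‖D ω‖ ≤ δ} + P.real bad := by
    calc (1 : ℝ) = P.real Set.univ := probReal_univ.symm
      _ ≤ _ := measureReal_mono hcover
      _ ≤ _ := measureReal_union_le _ _
  linarith
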